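/- **Setting.** Let $\mathcal P$ be a nonempty hereditary family of finite posets, each with a least element $0_P$ and a greatest element $1_P$: with $P$ it contains all intervals $[x,y]\subseteq P$, and with $P,Q$ it contains the direct product $P\times Q$. Let $\sim$ be a reduced order-compatible semigroup relation on $\mathcal P$, i.e. an equivalence relation such that * if $P\sim Q$, there is a bijection $\varphi:P\to Q$ with $[0_P,x]\sim[0_Q,\varphi(x)]$ and $[x,1_P]\sim[\varphi(x),1_Q]$ for all $x\in P$; * $P\times Q\sim Q\times P\sim P$ whenever $Q$ has one element; * the product $\overline P\cdot\overline Q=\overline{P\times Q}$ of classes ("types") is well defined and associative. Let $\mathbb K$ be a field. The incidence Hopf algebra $H(\mathcal P)$ is the vector space with basis the set $\overline{\mathcal P}=\mathcal P/{\sim}$ of types, with the product above, coproduct $\Delta(\overline P)=\sum_{x\in P}\overline{[0_P,x]}\otimes\overline{[x,1_P]}$, and counit $\varepsilon(\overline P)=1$ if $|P|=1$ and $0$ otherwise; $S$ denotes its antipode. A poset is graded if all its maximal chains $0_P\lessdot\cdots\lessdot 1_P$ have the same number of steps, called its rank. A poset $R\in\mathcal P$ is indecomposable if it is not isomorphic to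 $P\times Q$ with $P,Q\in\mathcal P$, $|P|,|Q|>1$; $\overline{\mathcal P}_0$ is the set of types of indecomposable posets. The pair $(\mathcal P,\sim)$ is a *uniform family* if all its posets are graded and 1. if $\overline P\in\overline{\mathcal P}_0$, $y\in P$ and $y<1_P$, then $\overline{[y,1_P]}\in\overline{\mathcal P}_0$; 2. for every $n\ge1$ there is exactly one type in $\overline{\mathcal P}_0$ of rank $n$. For each $n\geq 0$ choose an indecomposable $P_n\in\mathcal P$ of rank $n$, let $x_n=\overline{P_n}$ (so $x_0=1$), and define the rank polynomials $$W_{n,k}=\sum_{z\in P_n,\ \operatorname{rank}[z,1_{P_n}]=k}\overline{[0_{P_n},z]}\in H(\mathcal P).$$ For $n\ge1$ let $M_n$ be the $n\times n$ matrix whose $(i,j)$ entry is $W_{n-i+1,\,n-j}$. For a square matrix $A$ over a ring, let $A^{pq}$ be $A$ with row $p$ and column $q$ deleted; if $A^{pq}$ is invertible, the quasideterminant is $|A|_{pq}=a_{pq}-\sum_{i\ne p,\,j\ne q}a_{pj}\,\big((A^{pq})^{-1}\big)_{ji}\,a_{iq}$. **Theorem.** Let $(\mathcal P,\sim)$ be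 a uniform family (commutative or not). 1. For every $n\ge1$ the matrix $(M_n)^{1n}$ is invertible over $H(\mathcal P)$ and $$S(x_n)=-\,|M_n|_{1n}.$$ 2. If the monoid $\overline{\mathcal P}$ of types is freely generated by $x_1,x_2,\dots$ (the free noncommutative case), then $H(\mathcal P)$ is isomorphic as a graded algebra to the free associative algebra $\mathbb K\langle x_1,x_2,\dots\rangle$ with $\deg x_n=n$, the generator $x_n$ corresponding to the type $x_n$; here the degree $d$ component of $H(\mathcal P)$ is spanned by the types of rank $d$. 3. If the family is commutative ($P\times Q\sim Q\times P$ for all $P,Q\in\mathcal P$), then $S(x_n)=(-1)^n\det M_n$ for all $n\ge1$. -/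

import Mathlib

open scoped TensorProduct

universe u v w

/-! ### Quasideterminants over a (noncommutative) ring -/

/-- The quasideterminant `|A|_{pq} = a_{pq} - ∑_{i ≠ p, j ≠ q} a_{pj} ((A^{pq})⁻¹)_{ji} a_{iq}`,
where `A^{pq}` is `A` with row `p` and column `q` deleted. It is meaningful when `A^{pq}` is
invertible in the ring of matrices over `S`. -/
noncomputable def quasiDet {S : Type w} [Ring S] {n : ℕ}
    (A : Matrix (Fin (n + 1)) (Fin (n + 1)) S) (p q : Fin (n + 1)) : S :=
  A p q - ∑ i : Fin n, ∑ j : Fin n,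
    A p (q.succAbove j) * Ring.inverse (A.submatrix p.succAbove q.succAbove) j i *
      A (p.succAbove i) q

/-! ### Graded posets -/

/-- All maximal chains `⊥ ⋖ ⋯ ⋖ ⊤` of the bounded poset `α` have length `n` (number of steps),
and there is one. -/
def HasRank (α : Type v) [PartialOrder α] [BoundedOrder α] (n : ℕ) : Prop :=
  (∃ s : RelSeries {(a, b) : α × α | a ⋖ b}, s.head = ⊥ ∧ s.last = ⊤ ∧ s.length = n) ∧
    ∀ s : RelSeries {(a, b) : α × α | a ⋖ b}, s.head = ⊥ → s.last = ⊤ → s.length = n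

/-- A bounded poset is graded if all its maximal chains have the same length. -/
def IsGradedPoset (α : Type v) [PartialOrder α] [BoundedOrder α] : Prop :=
  ∃ n, HasRank α n

/-! ### Hereditary families of posets -/

/-- A (nonempty) hereditary family of finite posets with `0` and `1`: an indexed family
`(Carrier i)` which is interval closed (every interval `[x, y]` of a member is, up to a chosen
identification, the member `interval i x y`) and closed under direct products. -/
structure HereditaryFamily where
  Idx : Type u
  Carrier : Idx → Type v
  [partialOrder : ∀ i, PartialOrder (Carrier i)]
  [boundedOrder : ∀ i, BoundedOrder (Carrier i)]
  [fintype : ∀ i, Fintype (Carrier i)]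
  nonempty : Nonempty Idx
  /-- the member of the family which is the interval `[x, y]` -/
  interval : ∀ (i : Idx) (x y : Carrier i), x ≤ y → Idx
  intervalIso : ∀ (i : Idx) (x y : Carrier i) (h : x ≤ y),
    Carrier (interval i x y h) ≃o Set.Icc x y
  /-- the member of the family which is the direct product -/
  prod : Idx → Idx → Idx
  prodIso : ∀ i j : Idx, Carrier (prod i j) ≃o Carrier i × Carrier j

attribute [instance] HereditaryFamily.partialOrder HereditaryFamily.boundedOrder
  HereditaryFamily.fintype

namespace HereditaryFamily

variable (F : HereditaryFamily.{u, v})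

/-- The interval `[0_P, x]`. -/
abbrev lower (i : F.Idx) (x : F.Carrier i) : F.Idx := F.interval i ⊥ x bot_le

/-- The interval `[x, 1_P]`. -/
abbrev upper (i : F.Idx) (x : F.Carrier i) : F.Idx := F.interval i x ⊤ le_top

/-- `R` is indecomposable if it is not isomorphic to a product `P × Q` of members of the family
with more than one element each. -/
def Indecomposable (i : F.Idx) : Prop :=
  ∀ j k : F.Idx, 1 < Fintype.card (F.Carrier j) → 1 < Fintype.card (F.Carrier k) →
    IsEmpty (F.Carrier i ≃o F.Carrier j × F.Carrier k)

end HereditaryFamily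

/-- A reduced order-compatible semigroup relation `∼` on a hereditary family.
The fields `rel_interval_bot_top`, `rel_interval_interval` and `rel_interval_prod` express that `∼`
does not distinguish between different names of one and the same poset (for subposets of a given
poset they are equalities of sets): `[0_P, 1_P]` is `P`, an interval of the interval `[x, y]` of `P`
is an interval of `P`, and `[(x, x'), (y, y')]` is `[x, y] × [x', y']`. The fields `rel_prod` and
`rel_prod_assoc` say that the product induces a semigroup structure on the quotient. -/
structure HopfRelation (F : HereditaryFamily.{u, v}) where
  setoid : Setoid F.Idx
  order_compatible : ∀ {i j : F.Idx}, setoid i j →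
    ∃ φ : F.Carrier i ≃ F.Carrier j, ∀ x : F.Carrier i,
      setoid (F.lower i x) (F.lower j (φ x)) ∧ setoid (F.upper i x) (F.upper j (φ x))
  reduced : ∀ i j : F.Idx, Fintype.card (F.Carrier j) = 1 →
    setoid (F.prod i j) i ∧ setoid (F.prod j i) i
  rel_prod : ∀ {i i' j j' : F.Idx}, setoid i i' → setoid j j' →
    setoid (F.prod i j) (F.prod i' j')
  rel_prod_assoc : ∀ i j k : F.Idx,
    setoid (F.prod (F.prod i j) k) (F.prod i (F.prod j k))
  rel_interval_bot_top : ∀ i : F.Idx, setoid (F.interval i ⊥ ⊤ bot_le) i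
  rel_interval_interval : ∀ (i : F.Idx) (x y : F.Carrier i) (h : x ≤ y)
    (a b : F.Carrier (F.interval i x y h)) (hab : a ≤ b),
    setoid (F.interval (F.interval i x y h) a b hab)
      (F.interval i (F.intervalIso i x y h a) (F.intervalIso i x y h b)
        ((F.intervalIso i x y h).monotone hab))
  rel_interval_prod : ∀ (i j : F.Idx) (z w : F.Carrier (F.prod i j)) (h : z ≤ w),
    setoid (F.interval (F.prod i j) z w h)
      (F.prod
        (F.interval i (F.prodIso i j z).1 (F.prodIso i j w).1 ((F.prodIso i j).monotone h).1)
        (F.interval j (F.prodIso i j z).2 (F.prodIso i j w).2 ((F.prodIso i j).monotone h).2))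

namespace HopfRelation

variable {F : HereditaryFamily.{u, v}} (R : HopfRelation F)

/-- The set of types: equivalence classes of members of the family. -/
def Types : Type u := Quotient R.setoid

/-- The type of a member of the family. -/
def type (i : F.Idx) : R.Types := Quotient.mk R.setoid i

variable {R} in
theorem type_eq {i j : F.Idx} (h : R.setoid i j) : R.type i = R.type j := Quotient.sound h

variable {R} in
theorem type_exact {i j : F.Idx} (h : R.type i = R.type j) : R.setoid i j := Quotient.exact h

theorem type_surj (t : R.Types) : ∃ i, R.type i = t := Quotient.exists_rep t

/-- The number of elements of the posets of a given type. -/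
noncomputable def card (t : R.Types) : ℕ :=
  Quotient.lift (fun i => Fintype.card (F.Carrier i))
    (fun _ _ h => Fintype.card_congr (R.order_compatible h).choose) t

@[simp] theorem card_type (i : F.Idx) : R.card (R.type i) = Fintype.card (F.Carrier i) := rfl

theorem card_interval_self (i : F.Idx) (x : F.Carrier i) (h : x ≤ x) :
    Fintype.card (F.Carrier (F.interval i x x h)) = 1 := by
  rw [Fintype.card_congr (F.intervalIso i x x h).toEquiv, Fintype.card_eq_one_iff]
  exact ⟨⟨x, by simp⟩, fun y => Subtype.ext (le_antisymm y.2.2 y.2.1)⟩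

theorem type_eq_of_card_one {i j : F.Idx} (hi : Fintype.card (F.Carrier i) = 1)
    (hj : Fintype.card (F.Carrier j) = 1) : R.type i = R.type j :=
  (type_eq (R.reduced i j hj).1).symm.trans (type_eq (R.reduced j i hi).2)

theorem exists_card_one : ∃ i : F.Idx, Fintype.card (F.Carrier i) = 1 :=
  let ⟨i⟩ := F.nonempty
  ⟨F.interval i ⊥ ⊥ le_rfl, card_interval_self i ⊥ le_rfl⟩

/-- The monoid of types: the product is induced by the direct product of posets, the unit is
the class of the one-element posets. -/
noncomputable instance : Monoid R.Types where
  mul s t := Quotient.map₂ F.prod (fun _ _ h _ _ h' => R.rel_prod h h') s t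
  one := R.type (exists_card_one (F := F)).choose
  mul_assoc a b c := by
    obtain ⟨i, rfl⟩ := R.type_surj a
    obtain ⟨j, rfl⟩ := R.type_surj b
    obtain ⟨k, rfl⟩ := R.type_surj c
    exact type_eq (R.rel_prod_assoc i j k)
  one_mul a := by
    obtain ⟨i, rfl⟩ := R.type_surj a
    exact type_eq (R.reduced i _ (exists_card_one (F := F)).choose_spec).2
  mul_one a := by
    obtain ⟨i, rfl⟩ := R.type_surj a
    exact type_eq (R.reduced i _ (exists_card_one (F := F)).choose_spec).1

theorem type_prod (i j : F.Idx) : R.type (F.prod i j) = R.type i * R.type j := rfl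

theorem type_eq_one {i : F.Idx} (h : Fintype.card (F.Carrier i) = 1) : R.type i = 1 :=
  R.type_eq_of_card_one h (exists_card_one (F := F)).choose_spec

theorem card_one : R.card 1 = 1 := (exists_card_one (F := F)).choose_spec

theorem card_eq_one {t : R.Types} : R.card t = 1 ↔ t = 1 := by
  refine ⟨fun h => ?_, fun h => h ▸ R.card_one⟩
  obtain ⟨i, rfl⟩ := R.type_surj t
  exact R.type_eq_one h

theorem card_mul (s t : R.Types) : R.card (s * t) = R.card s * R.card t := by
  obtain ⟨i, rfl⟩ := R.type_surj s
  obtain ⟨j, rfl⟩ := R.type_surj t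
  rw [← type_prod, card_type, card_type, card_type,
    Fintype.card_congr (F.prodIso i j).toEquiv, Fintype.card_prod]

end HopfRelation

/-! ### The incidence Hopf algebra -/

/-- The underlying vector space of the incidence Hopf algebra: freely spanned by the types, with
the product extending that of types. -/
def IncidenceHopf (K : Type w) [Field K] {F : HereditaryFamily.{u, v}} (R : HopfRelation F) :
    Type (max u w) := MonoidAlgebra K R.Types

namespace IncidenceHopf

variable (K : Type w) [Field K] {F : HereditaryFamily.{u, v}} (R : HopfRelation F)

noncomputable instance : Ring (IncidenceHopf K R) := inferInstanceAs (Ring (MonoidAlgebra K R.Types))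

noncomputable instance : Algebra K (IncidenceHopf K R) :=
  inferInstanceAs (Algebra K (MonoidAlgebra K R.Types))

/-- The basis element of a type. -/
noncomputable def of : R.Types →* IncidenceHopf K R := MonoidAlgebra.of K R.Types

/-- The class of a member of the family as an element of the incidence Hopf algebra. -/
noncomputable def cls (i : F.Idx) : IncidenceHopf K R := of K R (R.type i)

variable {K R} in
/-- Multiplicative functions on types extend to algebra morphisms. -/
noncomputable def lift {A : Type*} [Semiring A] [Algebra K A] (f : R.Types →* A) :
    IncidenceHopf K R →ₐ[K] A := MonoidAlgebra.lift K A R.Types f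

variable {K R} in
@[simp] theorem lift_of {A : Type*} [Semiring A] [Algebra K A] (f : R.Types →* A) (t : R.Types) :
    lift f (of K R t) = f t := MonoidAlgebra.lift_of (R := K) f t

variable {K R} in
theorem algHom_ext {A : Type*} [Semiring A] [Algebra K A] {f g : IncidenceHopf K R →ₐ[K] A}
    (h : ∀ i, f (cls K R i) = g (cls K R i)) : f = g := by
  refine (MonoidAlgebra.lift K A R.Types).symm.injective (MonoidHom.ext fun t => ?_)
  obtain ⟨i, rfl⟩ := R.type_surj t
  exact h i

variable {K R} in
theorem linearMap_ext {A : Type*} [AddCommMonoid A] [Module K A]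
    {f g : IncidenceHopf K R →ₗ[K] A}
    (h : ∀ i, f (cls K R i) = g (cls K R i)) : f = g := by
  refine MonoidAlgebra.lhom_ext' fun t => LinearMap.ext_ring ?_
  obtain ⟨i, rfl⟩ := R.type_surj t
  exact h i

/-- The coproduct `∑_{x ∈ P} [0_P, x] ⊗ [x, 1_P]` on types. -/
noncomputable def comulType (t : R.Types) : IncidenceHopf K R ⊗[K] IncidenceHopf K R :=
  Quotient.lift (fun i => ∑ x : F.Carrier i, cls K R (F.lower i x) ⊗ₜ[K] cls K R (F.upper i x))
    (fun i j h => by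
      obtain ⟨φ, hφ⟩ := R.order_compatible h
      refine Fintype.sum_equiv φ _ _ fun x => ?_
      simp only [cls, HopfRelation.type_eq (hφ x).1, HopfRelation.type_eq (hφ x).2]) t

theorem comulType_type (i : F.Idx) : comulType K R (R.type i) =
    ∑ x : F.Carrier i, cls K R (F.lower i x) ⊗ₜ[K] cls K R (F.upper i x) := rfl

theorem type_interval_congr {i : F.Idx} {x x' y y' : F.Carrier i} (h : x ≤ y) (hx : x = x')
    (hy : y = y') : F.interval i x y h = F.interval i x' y' (hx ▸ hy ▸ h) := by
  subst hx hy; rfl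

theorem intervalIso_bot (i : F.Idx) (x y : F.Carrier i) (h : x ≤ y) :
    (F.intervalIso i x y h ⊥ : F.Carrier i) = x := by
  apply le_antisymm _ (F.intervalIso i x y h ⊥).2.1
  have := (F.intervalIso i x y h).monotone (bot_le (a := (F.intervalIso i x y h).symm ⟨x, by simp [h]⟩))
  rw [OrderIso.apply_symm_apply] at this
  exact this

theorem intervalIso_top (i : F.Idx) (x y : F.Carrier i) (h : x ≤ y) :
    (F.intervalIso i x y h ⊤ : F.Carrier i) = y := by
  apply le_antisymm (F.intervalIso i x y h ⊤).2.2
  have := (F.intervalIso i x y h).monotone (le_top (a := (F.intervalIso i x y h).symm ⟨y, by simp [h]⟩))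
  rw [OrderIso.apply_symm_apply] at this
  exact this

theorem comulType_one : comulType K R 1 = 1 := by
  obtain ⟨i, hi⟩ := HopfRelation.exists_card_one (F := F)
  obtain ⟨x, hx⟩ := Fintype.card_eq_one_iff.1 hi
  have key : ∀ a b (h : a ≤ b), R.type (F.interval i a b h) = 1 := by
    intro a b h
    obtain rfl : a = b := (hx a).trans (hx b).symm
    exact R.type_eq_one (HopfRelation.card_interval_self i a h)
  rw [← R.type_eq_one hi, comulType_type, Fintype.sum_eq_single x (fun y hy => (hy (hx y)).elim)]
  simp only [cls, HereditaryFamily.lower, HereditaryFamily.upper, key, map_one]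
  rfl

theorem comulType_mul (s t : R.Types) :
    comulType K R (s * t) = comulType K R s * comulType K R t := by
  obtain ⟨i, rfl⟩ := R.type_surj s
  obtain ⟨j, rfl⟩ := R.type_surj t
  rw [← HopfRelation.type_prod, comulType_type, comulType_type, comulType_type,
    Finset.sum_mul_sum, ← Fintype.sum_prod_type']
  refine Fintype.sum_equiv (F.prodIso i j).toEquiv _ _ fun z => ?_
  have hb : F.prodIso i j ⊥ = ⊥ := map_bot _
  have ht : F.prodIso i j ⊤ = ⊤ := map_top _
  have h1 := R.rel_interval_prod i j ⊥ z bot_le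
  have h2 := R.rel_interval_prod i j z ⊤ le_top
  have h1' := HopfRelation.type_eq h1
  have h2' := HopfRelation.type_eq h2
  rw [HopfRelation.type_prod, type_interval_congr _ (congrArg Prod.fst hb) rfl,
    type_interval_congr _ (congrArg Prod.snd hb) rfl] at h1'
  rw [HopfRelation.type_prod, type_interval_congr _ rfl (congrArg Prod.fst ht),
    type_interval_congr _ rfl (congrArg Prod.snd ht)] at h2'
  simp only [cls, HereditaryFamily.lower, HereditaryFamily.upper, Algebra.TensorProduct.tmul_mul_tmul,
    ← map_mul]
  rw [h1', h2']
  rfl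

/-- The coproduct `Δ(P) = ∑_{x ∈ P} [0_P, x] ⊗ [x, 1_P]`. -/
noncomputable def comulHom :
    IncidenceHopf K R →ₐ[K] IncidenceHopf K R ⊗[K] IncidenceHopf K R :=
  lift
    { toFun := comulType K R
      map_one' := comulType_one K R
      map_mul' := comulType_mul K R }

theorem comulHom_cls (i : F.Idx) : comulHom K R (cls K R i) =
    ∑ x : F.Carrier i, cls K R (F.lower i x) ⊗ₜ[K] cls K R (F.upper i x) := by
  simp only [cls, comulHom, lift_of]
  rfl

open Classical in
/-- The counit, `1` on one-element posets and `0` on the others. -/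
noncomputable def counitHom : IncidenceHopf K R →ₐ[K] K :=
  lift
    { toFun := fun t => if R.card t = 1 then 1 else 0
      map_one' := by simp [R.card_one]
      map_mul' := fun s t => by
        simp only [R.card_mul, mul_eq_one]
        by_cases h1 : R.card s = 1 <;> by_cases h2 : R.card t = 1 <;> simp [h1, h2] }

open Classical in
theorem counitHom_cls (i : F.Idx) :
    counitHom K R (cls K R i) = if Fintype.card (F.Carrier i) = 1 then 1 else 0 := by
  simp only [cls, counitHom, lift_of]
  rfl

open Classical in
/-- The class of `[x, y]`, extended by `0` to pairs which are not ordered. -/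
noncomputable def ivl (i : F.Idx) (x y : F.Carrier i) : IncidenceHopf K R :=
  if h : x ≤ y then cls K R (F.interval i x y h) else 0

theorem ivl_of_le {i : F.Idx} {x y : F.Carrier i} (h : x ≤ y) :
    ivl K R i x y = cls K R (F.interval i x y h) := dif_pos h

theorem ivl_of_not_le {i : F.Idx} {x y : F.Carrier i} (h : ¬ x ≤ y) : ivl K R i x y = 0 :=
  dif_neg h

theorem cls_interval_interval (i : F.Idx) (x y : F.Carrier i) (h : x ≤ y)
    (a b : F.Carrier (F.interval i x y h)) (hab : a ≤ b) :
    cls K R (F.interval (F.interval i x y h) a b hab) =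
      ivl K R i (F.intervalIso i x y h a) (F.intervalIso i x y h b) := by
  rw [ivl_of_le K R (show (F.intervalIso i x y h a : F.Carrier i) ≤ F.intervalIso i x y h b from
    (F.intervalIso i x y h).monotone hab)]
  exact congrArg (of K R) (HopfRelation.type_eq (R.rel_interval_interval i x y h a b hab))

theorem sum_interval {M : Type*} [AddCommMonoid M] (i : F.Idx) (a b : F.Carrier i) (h : a ≤ b)
    (f : F.Carrier i → M) (hf : ∀ y, ¬ (a ≤ y ∧ y ≤ b) → f y = 0) :
    ∑ z : F.Carrier (F.interval i a b h), f (F.intervalIso i a b h z) = ∑ y, f y := by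
  refine Finset.sum_of_injOn (fun z => (F.intervalIso i a b h z : F.Carrier i)) ?_ ?_ ?_ ?_
  · intro z _ z' _ hz
    exact (F.intervalIso i a b h).injective (Subtype.ext hz)
  · intro z _; simp
  · intro y _ hy
    refine hf y fun hy' => hy ⟨(F.intervalIso i a b h).symm ⟨y, hy'⟩, by simp, by simp⟩
  · intro z _; rfl

theorem coassoc_aux :
    (Algebra.TensorProduct.assoc K K K (IncidenceHopf K R) (IncidenceHopf K R)
        (IncidenceHopf K R)).toAlgHom.comp
      ((Algebra.TensorProduct.map (comulHom K R) (.id K _)).comp (comulHom K R)) =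
    (Algebra.TensorProduct.map (.id K _) (comulHom K R)).comp (comulHom K R) := by
  refine algHom_ext fun i => ?_
  have hL : ∀ x : F.Carrier i,
      ∑ z : F.Carrier (F.lower i x), cls K R (F.lower (F.lower i x) z) ⊗ₜ[K]
        (cls K R (F.upper (F.lower i x) z) ⊗ₜ[K] cls K R (F.upper i x)) =
      ∑ y : F.Carrier i, ivl K R i ⊥ y ⊗ₜ[K] (ivl K R i y x ⊗ₜ[K] ivl K R i x ⊤) := by
    intro x
    rw [← sum_interval i ⊥ x bot_le
      (fun y => ivl K R i ⊥ y ⊗ₜ[K] (ivl K R i y x ⊗ₜ[K] ivl K R i x ⊤))]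
    · refine Finset.sum_congr rfl fun z _ => ?_
      rw [cls_interval_interval, cls_interval_interval,
        intervalIso_bot, intervalIso_top, ivl_of_le K R (le_top (a := x))]
    · intro y hy
      rw [ivl_of_not_le K R (fun h => hy ⟨bot_le, h⟩)]
      simp
  have hR : ∀ y : F.Carrier i,
      ∑ z : F.Carrier (F.upper i y), cls K R (F.lower i y) ⊗ₜ[K]
        (cls K R (F.lower (F.upper i y) z) ⊗ₜ[K] cls K R (F.upper (F.upper i y) z)) =
      ∑ x : F.Carrier i, ivl K R i ⊥ y ⊗ₜ[K] (ivl K R i y x ⊗ₜ[K] ivl K R i x ⊤) := by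
    intro y
    rw [← sum_interval i y ⊤ le_top
      (fun x => ivl K R i ⊥ y ⊗ₜ[K] (ivl K R i y x ⊗ₜ[K] ivl K R i x ⊤))]
    · refine Finset.sum_congr rfl fun z _ => ?_
      rw [cls_interval_interval, cls_interval_interval,
        intervalIso_bot, intervalIso_top, ivl_of_le K R (bot_le (a := y))]
    · intro x hx
      rw [ivl_of_not_le K R (fun h => hx ⟨h, le_top⟩)]
      simp
  have e1 : (Algebra.TensorProduct.assoc K K K (IncidenceHopf K R) (IncidenceHopf K R)
        (IncidenceHopf K R)).toAlgHom.comp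
      ((Algebra.TensorProduct.map (comulHom K R) (.id K _)).comp (comulHom K R)) (cls K R i) =
      ∑ x : F.Carrier i, ∑ z : F.Carrier (F.lower i x), cls K R (F.lower (F.lower i x) z) ⊗ₜ[K]
        (cls K R (F.upper (F.lower i x) z) ⊗ₜ[K] cls K R (F.upper i x)) := by
    simp [comulHom_cls, TensorProduct.sum_tmul, map_sum]
  have e2 : (Algebra.TensorProduct.map (.id K _) (comulHom K R)).comp (comulHom K R) (cls K R i) =
      ∑ y : F.Carrier i, ∑ z : F.Carrier (F.upper i y), cls K R (F.lower i y) ⊗ₜ[K]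
        (cls K R (F.lower (F.upper i y) z) ⊗ₜ[K] cls K R (F.upper (F.upper i y) z)) := by
    simp [comulHom_cls, TensorProduct.tmul_sum, map_sum]
  rw [e1, e2, Finset.sum_congr rfl fun x _ => hL x, Finset.sum_congr rfl fun x _ => hR x,
    Finset.sum_comm]

theorem card_lower_le (i : F.Idx) (x : F.Carrier i) :
    Fintype.card (F.Carrier (F.lower i x)) ≤ Fintype.card (F.Carrier i) :=
  Fintype.card_le_of_injective (fun z => (F.intervalIso i ⊥ x bot_le z : F.Carrier i))
    fun _ _ h => (F.intervalIso i ⊥ x bot_le).injective (Subtype.ext h)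

theorem card_lower_lt (i : F.Idx) {x : F.Carrier i} (hx : x ≠ ⊤) :
    Fintype.card (F.Carrier (F.lower i x)) < Fintype.card (F.Carrier i) :=
  Fintype.card_lt_of_injective_of_notMem
    (fun z => (F.intervalIso i ⊥ x bot_le z : F.Carrier i))
    (fun _ _ h => (F.intervalIso i ⊥ x bot_le).injective (Subtype.ext h)) (b := ⊤)
    (by rintro ⟨z, hz⟩
        exact hx (top_le_iff.1 (hz ▸ (F.intervalIso i ⊥ x bot_le z).2.2)))

theorem card_interval_ne_one {i : F.Idx} {x y : F.Carrier i} (h : x ≤ y) (hxy : x ≠ y) :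
    Fintype.card (F.Carrier (F.interval i x y h)) ≠ 1 := by
  intro hc
  obtain ⟨z, hz⟩ := Fintype.card_eq_one_iff.1 hc
  have := (F.intervalIso i x y h).symm.injective
    ((hz ((F.intervalIso i x y h).symm ⟨x, le_rfl, h⟩)).trans
      (hz ((F.intervalIso i x y h).symm ⟨y, h, le_rfl⟩)).symm)
  exact hxy (congrArg Subtype.val this)

theorem counit_lower (i : F.Idx) (x : F.Carrier i) (hx : x ≠ ⊥) :
    counitHom K R (cls K R (F.lower i x)) = 0 := by
  rw [counitHom_cls, if_neg (card_interval_ne_one _ hx.symm)]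

theorem counit_upper (i : F.Idx) (x : F.Carrier i) (hx : x ≠ ⊤) :
    counitHom K R (cls K R (F.upper i x)) = 0 := by
  rw [counitHom_cls, if_neg (card_interval_ne_one _ hx)]

theorem counit_lower_bot (i : F.Idx) : counitHom K R (cls K R (F.lower i ⊥)) = 1 := by
  rw [counitHom_cls, if_pos (HopfRelation.card_interval_self i ⊥ _)]

theorem counit_upper_top (i : F.Idx) : counitHom K R (cls K R (F.upper i ⊤)) = 1 := by
  rw [counitHom_cls, if_pos (HopfRelation.card_interval_self i ⊤ _)]

theorem cls_upper_bot (i : F.Idx) : cls K R (F.upper i ⊥) = cls K R i :=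
  congrArg (of K R) (HopfRelation.type_eq (R.rel_interval_bot_top i))

theorem cls_lower_top (i : F.Idx) : cls K R (F.lower i ⊤) = cls K R i :=
  congrArg (of K R) (HopfRelation.type_eq (R.rel_interval_bot_top i))

noncomputable instance : Bialgebra K (IncidenceHopf K R) :=
  Bialgebra.ofAlgHom (comulHom K R) (counitHom K R) (coassoc_aux K R)
    (algHom_ext fun i => by
      simp only [AlgHom.comp_apply, comulHom_cls, map_sum, Algebra.TensorProduct.map_tmul,
        AlgHom.id_apply]
      rw [Fintype.sum_eq_single ⊥ fun x hx => by rw [counit_lower K R i x hx, TensorProduct.zero_tmul],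
        counit_lower_bot, cls_upper_bot]
      rfl)
    (algHom_ext fun i => by
      simp only [AlgHom.comp_apply, comulHom_cls, map_sum, Algebra.TensorProduct.map_tmul,
        AlgHom.id_apply]
      rw [Fintype.sum_eq_single ⊤ fun x hx => by rw [counit_upper K R i x hx, TensorProduct.tmul_zero],
        counit_upper_top, cls_lower_top]
      rfl)

theorem comul_cls (i : F.Idx) : Coalgebra.comul (R := K) (cls K R i) =
    ∑ x : F.Carrier i, cls K R (F.lower i x) ⊗ₜ[K] cls K R (F.upper i x) := comulHom_cls K R i

open Classical in
theorem counit_cls (i : F.Idx) : Coalgebra.counit (R := K) (cls K R i) =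
    if Fintype.card (F.Carrier i) = 1 then 1 else 0 := counitHom_cls K R i

theorem card_upper_le (i : F.Idx) (x : F.Carrier i) :
    Fintype.card (F.Carrier (F.upper i x)) ≤ Fintype.card (F.Carrier i) :=
  Fintype.card_le_of_injective (fun z => (F.intervalIso i x ⊤ le_top z : F.Carrier i))
    fun _ _ h => (F.intervalIso i x ⊤ le_top).injective (Subtype.ext h)

/-- `η ∘ ε - id` in the convolution ring. -/
noncomputable def augProj : WithConv (IncidenceHopf K R →ₗ[K] IncidenceHopf K R) :=
  1 - WithConv.toConv LinearMap.id

theorem convMul_cls (f g : WithConv (IncidenceHopf K R →ₗ[K] IncidenceHopf K R)) (i : F.Idx) :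
    (f * g) (cls K R i) = ∑ x : F.Carrier i, f (cls K R (F.lower i x)) * g (cls K R (F.upper i x)) := by
  rw [LinearMap.convMul_apply, comul_cls]
  simp only [map_sum, TensorProduct.map_tmul, LinearMap.mul'_apply]

theorem augProj_pow_cls (n : ℕ) (i : F.Idx) (h : Fintype.card (F.Carrier i) ≤ n) :
    (augProj K R ^ n) (cls K R i) = 0 := by
  induction n generalizing i with
  | zero => exact absurd (Nat.le_zero.1 h) Fintype.card_ne_zero
  | succ n ih =>
    rw [pow_succ, convMul_cls]
    refine Finset.sum_eq_zero fun x _ => ?_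
    by_cases hx : x = ⊤
    · subst hx
      have h1 : cls K R (F.upper i ⊤) = 1 := by
        rw [cls, R.type_eq_one (HopfRelation.card_interval_self i ⊤ _), map_one]
      have : augProj K R (1 : IncidenceHopf K R) = 0 := by
        change algebraMap K _ (Coalgebra.counit (1 : IncidenceHopf K R)) - (1 : IncidenceHopf K R) = 0
        simp
      rw [h1, this, mul_zero]
    · rw [ih _ (Nat.lt_succ_iff.1 ((card_lower_lt i hx).trans_le h)), zero_mul]

/-- Truncations of the geometric series for the convolution inverse of the identity. -/
noncomputable def antipodeTrunc (n : ℕ) :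
    WithConv (IncidenceHopf K R →ₗ[K] IncidenceHopf K R) :=
  ∑ k ∈ Finset.range n, augProj K R ^ k

theorem antipodeTrunc_succ_cls (n : ℕ) (i : F.Idx) (h : Fintype.card (F.Carrier i) ≤ n) :
    antipodeTrunc K R (n + 1) (cls K R i) = antipodeTrunc K R n (cls K R i) := by
  rw [antipodeTrunc, Finset.sum_range_succ]
  change antipodeTrunc K R n (cls K R i) + (augProj K R ^ n) (cls K R i) = _
  rw [augProj_pow_cls K R n i h, add_zero]

theorem antipodeTrunc_cls (n : ℕ) (i : F.Idx) (h : Fintype.card (F.Carrier i) ≤ n) :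
    antipodeTrunc K R n (cls K R i) =
      antipodeTrunc K R (Fintype.card (F.Carrier i)) (cls K R i) := by
  induction n, h using Nat.le_induction with
  | base => rfl
  | succ n hn ih => rw [antipodeTrunc_succ_cls K R n i hn, ih]

/-- The antipode. -/
noncomputable def antipodeMap : IncidenceHopf K R →ₗ[K] IncidenceHopf K R :=
  Finsupp.linearCombination K (fun t : R.Types => antipodeTrunc K R (R.card t) (of K R t)) ∘ₗ
    (MonoidAlgebra.coeffLinearEquiv K : MonoidAlgebra K R.Types ≃ₗ[K] R.Types →₀ K).toLinearMap

theorem antipodeMap_cls (n : ℕ) (i : F.Idx) (h : Fintype.card (F.Carrier i) ≤ n) :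
    antipodeMap K R (cls K R i) = antipodeTrunc K R n (cls K R i) := by
  rw [antipodeTrunc_cls K R n i h]
  change Finsupp.linearCombination K _ (Finsupp.single (R.type i) (1 : K)) = _
  rw [Finsupp.linearCombination_single, one_smul]
  rfl

theorem antipode_mul_id :
    WithConv.toConv (antipodeMap K R) * WithConv.toConv LinearMap.id = 1 := by
  refine WithConv.ofConv_injective (linearMap_ext fun i => ?_)
  have h := geom_sum_mul_neg (augProj K R) (Fintype.card (F.Carrier i))
  have h1 : 1 - augProj K R = WithConv.toConv LinearMap.id := by simp [augProj]
  rw [h1] at h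
  have h2 := congrArg (fun f : WithConv (IncidenceHopf K R →ₗ[K] IncidenceHopf K R) =>
    f (cls K R i)) h
  simp only [convMul_cls] at h2
  change (WithConv.toConv (antipodeMap K R) * WithConv.toConv LinearMap.id :
    WithConv (IncidenceHopf K R →ₗ[K] IncidenceHopf K R)) (cls K R i) =
    (1 : WithConv (IncidenceHopf K R →ₗ[K] IncidenceHopf K R)) (cls K R i)
  rw [convMul_cls]
  refine Eq.trans (Finset.sum_congr rfl fun x _ => ?_) (h2.trans ?_)
  · exact congrArg (· * _) (antipodeMap_cls K R _ _ (card_lower_le i x))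
  · change (1 : WithConv (IncidenceHopf K R →ₗ[K] IncidenceHopf K R)) (cls K R i) -
      (augProj K R ^ _) (cls K R i) = _
    rw [augProj_pow_cls K R _ i le_rfl, sub_zero]

theorem id_mul_antipode :
    WithConv.toConv LinearMap.id * WithConv.toConv (antipodeMap K R) = 1 := by
  refine WithConv.ofConv_injective (linearMap_ext fun i => ?_)
  have h := mul_neg_geom_sum (augProj K R) (Fintype.card (F.Carrier i))
  have h1 : 1 - augProj K R = WithConv.toConv LinearMap.id := by simp [augProj]
  rw [h1] at h
  have h2 := congrArg (fun f : WithConv (IncidenceHopf K R →ₗ[K] IncidenceHopf K R) =>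
    f (cls K R i)) h
  simp only [convMul_cls] at h2
  change (WithConv.toConv LinearMap.id * WithConv.toConv (antipodeMap K R) :
    WithConv (IncidenceHopf K R →ₗ[K] IncidenceHopf K R)) (cls K R i) =
    (1 : WithConv (IncidenceHopf K R →ₗ[K] IncidenceHopf K R)) (cls K R i)
  rw [convMul_cls]
  refine Eq.trans (Finset.sum_congr rfl fun x _ => ?_) (h2.trans ?_)
  · exact congrArg (_ * ·) (antipodeMap_cls K R _ _ (card_upper_le i x))
  · change (1 : WithConv (IncidenceHopf K R →ₗ[K] IncidenceHopf K R)) (cls K R i) -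
      (augProj K R ^ _) (cls K R i) = _
    rw [augProj_pow_cls K R _ i le_rfl, sub_zero]

/-- The incidence Hopf algebra `H(P)`. -/
noncomputable instance : HopfAlgebra K (IncidenceHopf K R) where
  antipode := antipodeMap K R
  mul_antipode_rTensor_comul := congrArg WithConv.ofConv (antipode_mul_id K R)
  mul_antipode_lTensor_comul := congrArg WithConv.ofConv (id_mul_antipode K R)

end IncidenceHopf

/-! ### Uniform families, rank polynomials and their matrices -/

namespace HopfRelation

variable {F : HereditaryFamily.{u, v}} (R : HopfRelation F)

/-- The set of types of indecomposable members of the family. -/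
def indecomposableTypes : Set R.Types := {t | ∃ i, F.Indecomposable i ∧ R.type i = t}

/-- A uniform family (commutative or noncommutative). -/
structure IsUniform : Prop where
  graded : ∀ i, IsGradedPoset (F.Carrier i)
  upper_mem : ∀ i, R.type i ∈ R.indecomposableTypes → ∀ y : F.Carrier i, y < ⊤ →
    R.type (F.upper i y) ∈ R.indecomposableTypes
  existsUnique : ∀ n : ℕ, 1 ≤ n →
    ∃! t : R.Types, t ∈ R.indecomposableTypes ∧ ∃ i, R.type i = t ∧ HasRank (F.Carrier i) n

/-- `∼` is commutative: `P × Q ∼ Q × P`. -/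
def IsCommutative : Prop := ∀ i j, R.setoid (F.prod i j) (F.prod j i)

/-- The monoid of types is freely generated by the types `x_n` of `P_n`, `n ≥ 1`. -/
def IsFreelyGeneratedBy (P : ℕ → F.Idx) : Prop :=
  Function.Bijective (FreeMonoid.lift fun n : ℕ+ => R.type (P n))

end HopfRelation

namespace IncidenceHopf

variable (K : Type w) [Field K] {F : HereditaryFamily.{u, v}} (R : HopfRelation F)

/-- The homogeneous component of degree `d`, spanned by the types of rank `d`. -/
noncomputable def gradedPiece (d : ℕ) : Submodule K (IncidenceHopf K R) :=
  Submodule.span K {h | ∃ i, HasRank (F.Carrier i) d ∧ h = cls K R i}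

open Classical in
/-- The rank polynomial `∑_{z ∈ P, rank [z, 1_P] = k} [0_P, z]`. When `P` is indecomposable of rank
`n` this is `W_{n,k}`. -/
noncomputable def rankPolynomial (i : F.Idx) (k : ℕ) : IncidenceHopf K R :=
  ∑ z : F.Carrier i with HasRank (F.Carrier (F.upper i z)) k, cls K R (F.lower i z)

/-- The `n × n` matrix with entries `W_{n-i+1,n-j}` (`1 ≤ i, j ≤ n`), where `P_m` is the chosen
indecomposable poset of rank `m`; the indices below start at `0`. -/
noncomputable def rankMatrix (P : ℕ → F.Idx) (n : ℕ) :
    Matrix (Fin n) (Fin n) (IncidenceHopf K R) :=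
  Matrix.of fun i j => rankPolynomial K R (P (n - i)) (n - (j + 1))

variable {R} in
/-- In the commutative case the incidence Hopf algebra is a commutative ring. -/
noncomputable abbrev commRing (h : R.IsCommutative) : CommRing (IncidenceHopf K R) :=
  { (inferInstance : Ring (IncidenceHopf K R)) with
    mul_comm := by
      have hc : ∀ i j, cls K R i * cls K R j = cls K R j * cls K R i := fun i j => by
        simp only [cls, ← map_mul, ← HopfRelation.type_prod]
        exact congrArg (of K R) (HopfRelation.type_eq (h i j))
      have : LinearMap.mul K (IncidenceHopf K R) = (LinearMap.mul K (IncidenceHopf K R)).flip :=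
        linearMap_ext fun i => linearMap_ext fun j => hc i j
      exact fun a b => LinearMap.congr_fun (LinearMap.congr_fun this a) b }

variable {R} in
/-- The classical determinant, in the commutative case. -/
noncomputable def det (h : R.IsCommutative) {n : ℕ}
    (A : Matrix (Fin n) (Fin n) (IncidenceHopf K R)) : IncidenceHopf K R :=
  letI := commRing K h
  A.det

end IncidenceHopf

/-- The component of degree `d` of the free associative algebra `K⟨x_1, x_2, …⟩` with
`deg x_n = n`. -/
noncomputable def freeAlgebraDegree (K : Type w) [Field K] (d : ℕ) : Submodule K (FreeAlgebra K ℕ+) :=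
  Submodule.span K {a | ∃ l : List ℕ+, (l.map fun n : ℕ+ => (n : ℕ)).sum = d ∧
    a = (l.map (FreeAlgebra.ι K)).prod}

/-! Everything rests on one half of the antipode axiom, the identity that `id * S` is the
convolution unit. On a poset with more than one element it says `∑_z [0,z] · S([z,1]) = 0`. In a
uniform family an upper interval of `P_n` of rank `k ≥ 1` is indecomposable, hence of type `x_k`;
for `k = 0` it is a point, of type `x_0 = 1`. Collecting the `z` with `rank [z,1] = k` gives `∑_k
W_{n,k} S(x_k) = 0` for every `n ≥ 1` (`sum_rankPolynomial_mul_antipode`).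

The recursions for `P_n, …, P_1` form one linear system. Since `W_{n,n} = 1` and `W_{m,k} = 0` for
`k > m`, the matrix `M_n` sends the column `(S(x_{n-1}), …, S(x_0))` to `(-S(x_n), 0, …, 0)`.
Deleting the first row and last column of `M_n` leaves an upper unitriangular matrix, which is
invertible over any ring, being `1` plus a nilpotent. As `S(x_0) = 1`, the lower rows can be solved
for the other entries of the column. Substituting the solution in the first row produces the
quasideterminant (`sum_mul_eq_quasiDet`); coefficients stay on the left throughout, so commutativity
plays no role. Over a commutative ring the adjugate extracts the determinant from the same system
(`det_eq_sum_mul`).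

In the free case the algebra isomorphism is formal. Its compatibility with the gradings requires
rank to be additive on products and to depend only on the type (`rank_eq_of_type_eq`); the latter is
not immediate, because an order-compatible bijection need not preserve the order. -/

/-! ### Linear algebra over noncommutative rings -/

/-- Powers of a strictly upper triangular matrix vanish below a moving diagonal. -/
theorem Matrix.pow_apply_eq_zero_of_strictUpper {S : Type w} [Ring S] {m : ℕ}
    {N : Matrix (Fin m) (Fin m) S} (hN : ∀ i j, j ≤ i → N i j = 0) (k : ℕ) :
    ∀ i j : Fin m, (j : ℕ) < i + k → (N ^ k) i j = 0 := by
  induction k with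
  | zero =>
    intro i j h
    rw [pow_zero, Matrix.one_apply_ne]
    rintro rfl
    omega
  | succ k ih =>
    intro i j h
    rw [pow_succ, Matrix.mul_apply]
    refine Finset.sum_eq_zero fun l _ => ?_
    by_cases hl : (l : ℕ) < i + k
    · rw [ih i l hl, zero_mul]
    · rw [hN l j (Fin.le_def.2 (by omega)), mul_zero]

/-- An upper unitriangular matrix over a ring is invertible. -/
theorem Matrix.isUnit_of_upper_unitriangular {S : Type w} [Ring S] {m : ℕ}
    {B : Matrix (Fin m) (Fin m) S} (hdiag : ∀ i, B i i = 1) (hlow : ∀ i j, j < i → B i j = 0) :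
    IsUnit B := by
  have hN : ∀ i j, j ≤ i → (B - 1) i j = 0 := by
    intro i j h
    rw [Matrix.sub_apply]
    obtain rfl | h := h.eq_or_lt
    · rw [hdiag, Matrix.one_apply_eq, sub_self]
    · rw [hlow i j h, Matrix.one_apply_ne h.ne', sub_zero]
  -- Exponent `m` suffices: every column index is less than `m`, hence less than `i + m`.
  have hnil : IsNilpotent (B - 1) :=
    ⟨m, Matrix.ext fun i j =>
      Matrix.pow_apply_eq_zero_of_strictUpper hN m i j (by omega)⟩
  simpa using hnil.isUnit_one_add

/-- If all rows of `A` but the first annihilate a column vector with last entry `1`, then the first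
row maps it to the quasideterminant of `A` at the top right corner. -/
theorem sum_mul_eq_quasiDet {S : Type w} [Ring S] {m : ℕ}
    (A : Matrix (Fin (m + 1)) (Fin (m + 1)) S)
    (hA : IsUnit (A.submatrix (Fin.succAbove 0) (Fin.succAbove (Fin.last m))))
    (s : Fin (m + 1) → S) (hlast : s (Fin.last m) = 1)
    (hs : ∀ i : Fin m, ∑ j, A i.succ j * s j = 0) :
    ∑ j, A 0 j * s j = quasiDet A 0 (Fin.last m) := by
  set B := A.submatrix (Fin.succAbove 0) (Fin.succAbove (Fin.last m)) with hB
  -- Since the last entry of `s` is `1`, the last column moves to the right-hand side and leaves a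
  -- square system for the other entries.
  have hBs : B.mulVec (fun j => s j.castSucc) = fun i => -A i.succ (Fin.last m) := by
    funext i
    have := hs i
    rw [Fin.sum_univ_castSucc, hlast, mul_one] at this
    simpa [B, Matrix.mulVec, dotProduct] using eq_neg_of_add_eq_zero_left this
  have hsol : ∀ j : Fin m, s j.castSucc = -∑ i, Ring.inverse B j i * A i.succ (Fin.last m) := by
    intro j
    have h := congrArg (Ring.inverse B).mulVec hBs
    rw [Matrix.mulVec_mulVec, Ring.inverse_mul_cancel B hA, Matrix.one_mulVec] at h
    simpa [Matrix.mulVec, dotProduct] using congrFun h j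
  rw [Fin.sum_univ_castSucc, hlast, mul_one, quasiDet, ← hB, Finset.sum_comm]
  simp only [Fin.succAbove_last, Fin.succAbove_zero, hsol, mul_neg, Finset.sum_neg_distrib,
    Finset.mul_sum, mul_assoc]
  abel

/-- Over a commutative ring, the same relations determine the determinant when the submatrix
opposite to the top right corner is upper unitriangular. -/
theorem det_eq_sum_mul {S : Type w} [CommRing S] {m : ℕ}
    (A : Matrix (Fin (m + 1)) (Fin (m + 1)) S)
    (hdiag : ∀ i : Fin m, A i.succ i.castSucc = 1)
    (hlow : ∀ i j : Fin m, j < i → A i.succ j.castSucc = 0)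
    (s : Fin (m + 1) → S) (hlast : s (Fin.last m) = 1)
    (hs : ∀ i : Fin m, ∑ j, A i.succ j * s j = 0) :
    A.det = (-1) ^ m * ∑ j, A 0 j * s j := by
  have hB : (A.submatrix (Fin.succAbove 0) (Fin.succAbove (Fin.last m))).det = 1 := by
    rw [Matrix.det_of_isUpperTriangular]
    · simp [hdiag]
    · intro i j h
      simpa using hlow i j h
  -- The last coordinate of `adj(A) · (A s) = det A · s` is `det A`. Only the first entry of `A s`
  -- survives, and its cofactor is `(-1) ^ m` times the unitriangular minor.
  have h := congrFun (congrArg (fun M => M.mulVec s) A.adjugate_mul) (Fin.last m)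
  simp only [← Matrix.mulVec_mulVec, Matrix.smul_mulVec, Matrix.one_mulVec, Pi.smul_apply, hlast,
    smul_eq_mul, mul_one] at h
  rw [← h, Matrix.mulVec, dotProduct, Fin.sum_univ_succ]
  have h0 : ∀ i : Fin m, A.mulVec s i.succ = 0 := hs
  simp only [h0, mul_zero, Finset.sum_const_zero, add_zero,
    Matrix.adjugate_fin_succ_eq_det_submatrix, hB, mul_one]
  simp [Matrix.mulVec, dotProduct]

/-! ### Saturated chains -/

/-- There is a saturated chain with `n` steps from `a` to `b`. -/
def SaturatedChain {α : Type v} [PartialOrder α] (a b : α) (n : ℕ) : Prop :=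
  ∃ s : RelSeries {(a, b) : α × α | a ⋖ b}, s.head = a ∧ s.last = b ∧ s.length = n

namespace SaturatedChain

variable {α β : Type*} [PartialOrder α] [PartialOrder β]

theorem refl (a : α) : SaturatedChain a a 0 := ⟨RelSeries.singleton _ a, rfl, rfl, rfl⟩

theorem of_covBy {a b : α} (h : a ⋖ b) : SaturatedChain a b 1 :=
  ⟨⟨1, ![a, b], fun i => by fin_cases i; exact h⟩, rfl, rfl, rfl⟩

theorem trans {a b c : α} {m n : ℕ} (h : SaturatedChain a b m) (h' : SaturatedChain b c n) :
    SaturatedChain a c (m + n) := by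
  obtain ⟨s, rfl, rfl, rfl⟩ := h
  obtain ⟨t, ht, rfl, rfl⟩ := h'
  exact ⟨s.smash t ht.symm, RelSeries.head_smash _, RelSeries.last_smash _, rfl⟩

theorem map {a b : α} {n : ℕ} (h : SaturatedChain a b n) (f : α → β)
    (hf : ∀ x y, x ⋖ y → f x ⋖ f y) : SaturatedChain (f a) (f b) n := by
  obtain ⟨s, rfl, rfl, rfl⟩ := h
  exact ⟨⟨s.length, f ∘ s.toFun, fun i => hf _ _ (s.step i)⟩, rfl, rfl, rfl⟩

theorem eq_of_zero {a b : α} (h : SaturatedChain a b 0) : a = b := by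
  obtain ⟨s, rfl, rfl, hs⟩ := h
  exact congrArg s.toFun (Fin.ext (by simp [hs]))

end SaturatedChain

theorem HasRank.saturatedChain {α : Type v} [PartialOrder α] [BoundedOrder α] {n : ℕ}
    (h : HasRank α n) : SaturatedChain (⊥ : α) ⊤ n := h.1

theorem HasRank.eq_of_saturatedChain {α : Type v} [PartialOrder α] [BoundedOrder α] {m n : ℕ}
    (h : HasRank α n) (h' : SaturatedChain (⊥ : α) ⊤ m) : m = n := by
  obtain ⟨s, hs, ht, rfl⟩ := h'
  exact h.2 s hs ht

theorem IsGradedPoset.hasRank_iff {α : Type v} [PartialOrder α] [BoundedOrder α]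
    (h : IsGradedPoset α) {n : ℕ} : HasRank α n ↔ SaturatedChain (⊥ : α) ⊤ n := by
  refine ⟨HasRank.saturatedChain, fun h' => ?_⟩
  obtain ⟨m, hm⟩ := h
  rwa [hm.eq_of_saturatedChain h']

theorem hasRank_zero_of_card_eq_one {α : Type v} [PartialOrder α] [BoundedOrder α] [Fintype α]
    (h : Fintype.card α = 1) : SaturatedChain (⊥ : α) ⊤ 0 := by
  obtain ⟨x, hx⟩ := Fintype.card_eq_one_iff.1 h
  rw [hx ⊥, hx ⊤]
  exact .refl x

theorem HasRank.card_eq_one {α : Type v} [PartialOrder α] [BoundedOrder α] [Fintype α]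
    (h : HasRank α 0) : Fintype.card α = 1 := by
  have hbt : (⊥ : α) = ⊤ := h.saturatedChain.eq_of_zero
  exact Fintype.card_eq_one_iff.2 ⟨⊥, fun y => le_antisymm (hbt ▸ le_top) bot_le⟩

/-! ### Ranks in a family of graded posets -/

namespace HereditaryFamily

variable {F : HereditaryFamily.{u, v}}

/-- `Set.Icc x y` is order convex, so a cover inside the interval is a cover in the ambient poset.
-/
theorem saturatedChain_interval {i : F.Idx} {x y : F.Carrier i} (h : x ≤ y) {n : ℕ}
    (hc : SaturatedChain (⊥ : F.Carrier (F.interval i x y h)) ⊤ n) : SaturatedChain x y n := by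
  have h1 := hc.map (fun z => (F.intervalIso i x y h z : F.Carrier i)) fun a b hab =>
    (Set.OrdConnected.apply_covBy_apply_iff (OrderEmbedding.subtype (· ∈ Set.Icc x y))
      (by simpa using! (Set.ordConnected_Icc (a := x) (b := y)))).2
        ((apply_covBy_apply_iff (F.intervalIso i x y h)).2 hab)
  simpa only [IncidenceHopf.intervalIso_bot, IncidenceHopf.intervalIso_top] using h1

/-- Climb in the first coordinate over `⊥`, then in the second coordinate over `⊤`. -/
theorem saturatedChain_prod {i j : F.Idx} {m n : ℕ}
    (hi : SaturatedChain (⊥ : F.Carrier i) ⊤ m) (hj : SaturatedChain (⊥ : F.Carrier j) ⊤ n) :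
    SaturatedChain (⊥ : F.Carrier (F.prod i j)) ⊤ (m + n) := by
  have h1 := (hi.map (fun x => (x, (⊥ : F.Carrier j))) fun _ _ =>
    Prod.mk_covBy_mk_iff_left.2).trans
    (hj.map (fun y => ((⊤ : F.Carrier i), y)) fun _ _ => Prod.mk_covBy_mk_iff_right.2)
  have h2 := h1.map (F.prodIso i j).symm fun _ _ => (apply_covBy_apply_iff _).2
  have hb : (F.prodIso i j).symm (⊥, ⊥) = ⊥ := map_bot (F.prodIso i j).symm
  have ht : (F.prodIso i j).symm (⊤, ⊤) = ⊤ := map_top (F.prodIso i j).symm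
  rwa [hb, ht] at h2

theorem card_upper_lt (i : F.Idx) {x : F.Carrier i} (hx : x ≠ ⊥) :
    Fintype.card (F.Carrier (F.upper i x)) < Fintype.card (F.Carrier i) :=
  Fintype.card_lt_of_injective_of_notMem
    (fun z => (F.intervalIso i x ⊤ le_top z : F.Carrier i))
    (fun _ _ h => (F.intervalIso i x ⊤ le_top).injective (Subtype.ext h)) (b := ⊥)
    (by rintro ⟨z, hz⟩
        exact hx (le_bot_iff.1 (hz ▸ (F.intervalIso i x ⊤ le_top z).2.1)))

/-- A poset of a family all of whose members are graded has a rank. -/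
noncomputable def rank (hF : ∀ i, IsGradedPoset (F.Carrier i)) (i : F.Idx) : ℕ := (hF i).choose

variable (hF : ∀ i, IsGradedPoset (F.Carrier i))

theorem hasRank_rank (i : F.Idx) : HasRank (F.Carrier i) (rank hF i) := (hF i).choose_spec

theorem hasRank_iff_rank_eq {i : F.Idx} {n : ℕ} : HasRank (F.Carrier i) n ↔ rank hF i = n :=
  ⟨fun h => h.eq_of_saturatedChain (hasRank_rank hF i).saturatedChain,
    fun h => h ▸ hasRank_rank hF i⟩

/-- By gradedness a single chain from `⊥` to `⊤` determines the rank, so the rank formulas that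
follow need only exhibit one. -/
theorem rank_eq_of_saturatedChain {i : F.Idx} {n : ℕ}
    (h : SaturatedChain (⊥ : F.Carrier i) ⊤ n) : rank hF i = n :=
  ((hasRank_rank hF i).eq_of_saturatedChain h).symm

theorem rank_eq_zero_iff {i : F.Idx} : rank hF i = 0 ↔ Fintype.card (F.Carrier i) = 1 :=
  ⟨fun h => ((hasRank_iff_rank_eq hF).2 h).card_eq_one,
    fun h => rank_eq_of_saturatedChain hF (hasRank_zero_of_card_eq_one h)⟩

theorem rank_prod (i j : F.Idx) : rank hF (F.prod i j) = rank hF i + rank hF j :=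
  rank_eq_of_saturatedChain hF
    (saturatedChain_prod (hasRank_rank hF i).saturatedChain (hasRank_rank hF j).saturatedChain)

/-- A saturated chain up to `x` followed by one from `x` is saturated from `⊥` to `⊤`. -/
theorem rank_lower_add_rank_upper (i : F.Idx) (x : F.Carrier i) :
    rank hF (F.lower i x) + rank hF (F.upper i x) = rank hF i :=
  (rank_eq_of_saturatedChain hF
    ((saturatedChain_interval _ (hasRank_rank hF (F.lower i x)).saturatedChain).trans
      (saturatedChain_interval _ (hasRank_rank hF (F.upper i x)).saturatedChain))).symm

theorem rank_eq_one_of_card_eq_two {i : F.Idx} (h : Fintype.card (F.Carrier i) = 2) :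
    rank hF i = 1 := by
  have hne : (⊥ : F.Carrier i) ≠ ⊤ := fun hbt => by
    have := Fintype.card_eq_one_iff.2
      ⟨(⊥ : F.Carrier i), fun y => le_antisymm (hbt ▸ le_top) bot_le⟩
    omega
  refine rank_eq_of_saturatedChain hF (.of_covBy ⟨bot_lt_iff_ne_bot.2 hne.symm, fun c hc hc' => ?_⟩)
  classical
  have := Finset.card_le_univ ({⊥, c, ⊤} : Finset (F.Carrier i))
  rw [Finset.card_eq_three.2 ⟨⊥, c, ⊤, hc.ne, hne, hc'.ne, rfl⟩] at this
  omega

end HereditaryFamily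

open HereditaryFamily

/-! ### Rank as a function of the type -/

namespace HopfRelation

variable {F : HereditaryFamily.{u, v}} (R : HopfRelation F)
  (hF : ∀ i, IsGradedPoset (F.Carrier i))

/-- The rank depends only on the type. -/
theorem rank_eq_of_type_eq {i j : F.Idx} (h : R.type i = R.type j) : rank hF i = rank hF j := by
  induction hn : Fintype.card (F.Carrier i) using Nat.strong_induction_on generalizing i j with
  | _ n ih =>
  subst hn
  obtain ⟨φ, hφ⟩ := R.order_compatible (type_exact h)
  have hcard := Fintype.card_congr φ
  -- Nothing is known about the order on the image of `φ`, but any `x` splits the rank into those of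
  -- its lower and upper intervals, and `φ` preserves their types. If `x` is neither `⊥` nor `⊤`,
  -- both intervals are smaller than the poset. Otherwise there are at most two elements, and
  -- cardinality, which `φ` preserves, fixes the rank.
  by_cases hx : ∃ x : F.Carrier i, x ≠ ⊥ ∧ x ≠ ⊤
  · obtain ⟨x, hb, ht⟩ := hx
    rw [← rank_lower_add_rank_upper hF i x, ← rank_lower_add_rank_upper hF j (φ x),
      ih _ (IncidenceHopf.card_lower_lt i ht) (type_eq (hφ x).1) rfl,
      ih _ (card_upper_lt i hb) (type_eq (hφ x).2) rfl]
  · push Not at hx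
    classical
    have hle : Fintype.card (F.Carrier i) ≤ 2 := by
      rw [← Finset.card_univ]
      refine (Finset.card_le_card fun x _ => ?_).trans
        (Finset.card_le_two (a := (⊥ : F.Carrier i)) (b := ⊤))
      by_cases hb : x = ⊥
      · simp [hb]
      · simp [hx x hb]
    have hpos : 0 < Fintype.card (F.Carrier i) := Fintype.card_pos
    obtain hc | hc : Fintype.card (F.Carrier i) = 1 ∨ Fintype.card (F.Carrier i) = 2 := by omega
    · rw [(rank_eq_zero_iff hF).2 hc, (rank_eq_zero_iff hF).2 (hcard ▸ hc)]
    · rw [rank_eq_one_of_card_eq_two hF hc, rank_eq_one_of_card_eq_two hF (hcard ▸ hc)]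

/-- The rank of a word in posets `P n` of rank `n` is the degree of the word. -/
theorem rank_of_type_eq_lift {P : ℕ → F.Idx} (hP : ∀ n, HasRank (F.Carrier (P n)) n)
    (l : FreeMonoid ℕ+) {i : F.Idx}
    (hi : R.type i = FreeMonoid.lift (fun n : ℕ+ => R.type (P n)) l) :
    rank hF i = (l.toList.map fun n : ℕ+ => (n : ℕ)).sum := by
  induction l using FreeMonoid.inductionOn' generalizing i with
  | one =>
    rw [map_one] at hi
    exact (rank_eq_zero_iff hF).2 ((R.card_type i).symm.trans (hi ▸ R.card_one))
  | of_mul n l ih =>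
    obtain ⟨j, hj⟩ := R.type_surj (FreeMonoid.lift (fun n : ℕ+ => R.type (P n)) l)
    rw [map_mul, FreeMonoid.lift_eval_of, ← hj, ← type_prod] at hi
    rw [R.rank_eq_of_type_eq hF hi, rank_prod, ih hj, (hasRank_iff_rank_eq hF).1 (hP n)]
    simp

variable {R} in
/-- The upper intervals of an indecomposable poset of a uniform family have the types `x_k`. -/
theorem IsUniform.type_upper (hR : R.IsUniform) {P : ℕ → F.Idx}
    (hP : ∀ n, F.Indecomposable (P n) ∧ HasRank (F.Carrier (P n)) n) (n : ℕ)
    (z : F.Carrier (P n)) :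
    R.type (F.upper (P n) z) = R.type (P (rank hR.graded (F.upper (P n) z))) := by
  -- Rank `0` is separate because the uniformity conditions concern only `y < ⊤` and ranks at least
  -- `1`.
  obtain hk | hk := Nat.eq_zero_or_pos (rank hR.graded (F.upper (P n) z))
  · rw [hk]
    exact R.type_eq_of_card_one ((rank_eq_zero_iff hR.graded).1 hk) (hP 0).2.card_eq_one
  · refine (hR.existsUnique _ hk).unique
      ⟨hR.upper_mem (P n) ⟨P n, (hP n).1, rfl⟩ z (lt_top_iff_ne_top.2 ?_),
        _, rfl, hasRank_rank hR.graded _⟩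
      ⟨⟨_, (hP _).1, rfl⟩, _, rfl, (hP _).2⟩
    rintro rfl
    exact hk.ne' ((rank_eq_zero_iff hR.graded).2 (card_interval_self _ _ _))

end HopfRelation

/-! ### Rank polynomials, the antipode and the free case -/

namespace IncidenceHopf

variable (K : Type w) [Field K] {F : HereditaryFamily.{u, v}} (R : HopfRelation F)

theorem rankPolynomial_eq_zero (hF : ∀ i, IsGradedPoset (F.Carrier i))
    {i : F.Idx} {n k : ℕ} (hi : HasRank (F.Carrier i) n) (h : n < k) :
    rankPolynomial K R i k = 0 := by
  classical
  refine Finset.sum_eq_zero fun z hz => ?_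
  have h1 := (hasRank_iff_rank_eq hF).1 (Finset.mem_filter.1 hz).2
  have h2 := rank_lower_add_rank_upper hF i z
  have h3 := (hasRank_iff_rank_eq hF).1 hi
  omega

/-- Rank additivity forces `[0, z]` to have rank `0`, so only `z = ⊥` contributes. -/
theorem rankPolynomial_self (hF : ∀ i, IsGradedPoset (F.Carrier i))
    {i : F.Idx} {n : ℕ} (hi : HasRank (F.Carrier i) n) :
    rankPolynomial K R i n = 1 := by
  classical
  have h3 := (hasRank_iff_rank_eq hF).1 hi
  have hbot : rank hF (F.lower i ⊥) = 0 :=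
    (rank_eq_zero_iff hF).2 (HopfRelation.card_interval_self _ _ _)
  rw [rankPolynomial, Finset.sum_eq_single ⊥]
  · rw [cls, R.type_eq_one (HopfRelation.card_interval_self i ⊥ _), map_one]
  · intro z hz hzb
    have h1 := (hasRank_iff_rank_eq hF).1 (Finset.mem_filter.1 hz).2
    have h2 := rank_lower_add_rank_upper hF i z
    exact absurd ((rank_eq_zero_iff hF).1 (by omega : rank hF (F.lower i z) = 0))
      (card_interval_ne_one _ hzb.symm)
  · intro h
    refine absurd (Finset.mem_filter.2
      ⟨Finset.mem_univ (⊥ : F.Carrier i), (hasRank_iff_rank_eq hF).2 ?_⟩) h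
    have h2 := rank_lower_add_rank_upper hF i ⊥
    omega

/-! ### The antipode recursion as a linear system -/

/-- The defining property of the antipode on a poset with more than one element. -/
theorem sum_cls_mul_antipode {i : F.Idx} (hi : Fintype.card (F.Carrier i) ≠ 1) :
    ∑ z : F.Carrier i,
      cls K R (F.lower i z) * HopfAlgebra.antipode K (cls K R (F.upper i z)) = 0 := by
  have h := HopfAlgebra.mul_antipode_lTensor_comul_apply (R := K) (cls K R i)
  rw [comul_cls, counit_cls, if_neg hi, map_zero] at h
  simpa using h

variable {R} in
/-- The recursion `∑_k W_{n,k} S(x_k) = 0` for the antipode. -/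
theorem sum_rankPolynomial_mul_antipode (hR : R.IsUniform) {P : ℕ → F.Idx}
    (hP : ∀ n, F.Indecomposable (P n) ∧ HasRank (F.Carrier (P n)) n) {n N : ℕ} (hn : 1 ≤ n)
    (hN : n < N) :
    ∑ k ∈ Finset.range N,
      rankPolynomial K R (P n) k * HopfAlgebra.antipode K (cls K R (P k)) = 0 := by
  classical
  have hrk := (hasRank_iff_rank_eq hR.graded).1 (hP n).2
  have hc : Fintype.card (F.Carrier (P n)) ≠ 1 := fun h => by
    have := (rank_eq_zero_iff hR.graded).2 h
    omega
  -- On the fiber where `[z, 1]` has rank `k`, the right factor is constantly `S(x_k)` and the left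
  -- factors add up to `W_{n,k}`. Any `N > n` covers all fibers, which lets posets of different
  -- ranks share one summation range.
  rw [← sum_cls_mul_antipode K R hc, ← Finset.sum_fiberwise_of_maps_to
    (t := Finset.range N) (g := fun z => rank hR.graded (F.upper (P n) z))]
  · refine Finset.sum_congr rfl fun k _ => ?_
    rw [rankPolynomial, Finset.sum_mul]
    refine Finset.sum_congr (Finset.filter_congr fun z _ => hasRank_iff_rank_eq hR.graded)
      fun z hz => ?_
    have ht : cls K R (F.upper (P n) z) = cls K R (P k) := by
      rw [cls, cls, hR.type_upper hP n z, (Finset.mem_filter.1 hz).2]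
    rw [ht]
  · intro z _
    have := rank_lower_add_rank_upper hR.graded (P n) z
    exact Finset.mem_range.2 (by omega)

variable {R} in
/-- The rows of the matrix of rank polynomials, applied to `(S(x_{n-1}), …, S(x_0))`. -/
theorem sum_rankMatrix_mul_antipode (hR : R.IsUniform) {P : ℕ → F.Idx}
    (hP : ∀ n, F.Indecomposable (P n) ∧ HasRank (F.Carrier (P n)) n) {n : ℕ} (i : Fin n) :
    rankPolynomial K R (P (n - i)) n * HopfAlgebra.antipode K (cls K R (P n)) +
      ∑ j : Fin n, rankMatrix K R P n i j *
        HopfAlgebra.antipode K (cls K R (P (n - (j + 1)))) = 0 := by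
  -- Every row uses the range `k ≤ n`, whatever the rank `n - i` of its poset. The term `k = n` is
  -- split off, and reflection puts the others in the column order `k = n - (j + 1)`.
  have h := sum_rankPolynomial_mul_antipode K hR hP (n := n - i) (N := n + 1)
    (by omega) (by omega)
  rw [Finset.sum_range_succ, add_comm, ← Finset.sum_range_reflect, Finset.sum_range] at h
  rw [← h]
  congr 1
  refine Finset.sum_congr rfl fun j _ => ?_
  rw [rankMatrix, Matrix.of_apply, Nat.sub_sub, add_comm 1 (j : ℕ)]

-- In the first row the term split off has coefficient `W_{n,n} = 1`, which isolates `S(x_n)`.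
variable {R} in
theorem antipode_cls_eq_neg_sum (hR : R.IsUniform) {P : ℕ → F.Idx}
    (hP : ∀ n, F.Indecomposable (P n) ∧ HasRank (F.Carrier (P n)) n) (m : ℕ) :
    HopfAlgebra.antipode K (cls K R (P (m + 1))) =
      -∑ j : Fin (m + 1), rankMatrix K R P (m + 1) 0 j *
        HopfAlgebra.antipode K (cls K R (P (m + 1 - (j + 1)))) := by
  have h := sum_rankMatrix_mul_antipode K hR hP (0 : Fin (m + 1))
  rw [Fin.val_zero, Nat.sub_zero, rankPolynomial_self K R hR.graded (hP _).2, one_mul] at h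
  exact eq_neg_of_add_eq_zero_left h

-- These rows come from posets of rank less than `m + 1`, so the coefficient of `S(x_{m+1})`
-- vanishes.
variable {R} in
theorem sum_rankMatrix_succ_mul_antipode (hR : R.IsUniform) {P : ℕ → F.Idx}
    (hP : ∀ n, F.Indecomposable (P n) ∧ HasRank (F.Carrier (P n)) n) {m : ℕ} (i : Fin m) :
    ∑ j : Fin (m + 1), rankMatrix K R P (m + 1) i.succ j *
      HopfAlgebra.antipode K (cls K R (P (m + 1 - (j + 1)))) = 0 := by
  have h := sum_rankMatrix_mul_antipode K hR hP i.succ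
  rwa [rankPolynomial_eq_zero K R hR.graded (hP _).2 (by simp), zero_mul, zero_add] at h

/-- A diagonal entry of `M_n` without its first row and last column: here both the rank of the poset
and the index of the rank polynomial are `m - i`. -/
theorem rankMatrix_succ_castSucc (hF : ∀ i, IsGradedPoset (F.Carrier i))
    {P : ℕ → F.Idx} (hP : ∀ n, HasRank (F.Carrier (P n)) n) {m : ℕ}
    (i : Fin m) : rankMatrix K R P (m + 1) i.succ i.castSucc = 1 :=
  rankPolynomial_self K R hF (hP _)

theorem rankMatrix_succ_castSucc_of_lt (hF : ∀ i, IsGradedPoset (F.Carrier i))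
    {P : ℕ → F.Idx} (hP : ∀ n, HasRank (F.Carrier (P n)) n)
    {m : ℕ} {i j : Fin m} (h : j < i) : rankMatrix K R P (m + 1) i.succ j.castSucc = 0 :=
  rankPolynomial_eq_zero K R hF (hP _) (by simp; omega)

theorem antipode_cls_zero {P : ℕ → F.Idx} (hP : ∀ n, HasRank (F.Carrier (P n)) n) :
    HopfAlgebra.antipode K (cls K R (P 0)) = 1 := by
  rw [cls, R.type_eq_one (hP 0).card_eq_one, map_one, HopfAlgebra.antipode_one]

/-! ### The free case -/

variable {R} in
/-- In the free case the incidence Hopf algebra is a free associative algebra. -/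
noncomputable def freeAlgebraEquiv {P : ℕ → F.Idx} (h : R.IsFreelyGeneratedBy P) :
    FreeAlgebra K ℕ+ ≃ₐ[K] IncidenceHopf K R :=
  FreeAlgebra.equivMonoidAlgebraFreeMonoid.trans
    (MonoidAlgebra.domCongr K K (MulEquiv.ofBijective _ h) :
      MonoidAlgebra K (FreeMonoid ℕ+) ≃ₐ[K] MonoidAlgebra K R.Types)

variable {R} in
theorem freeAlgebraEquiv_ι {P : ℕ → F.Idx} (h : R.IsFreelyGeneratedBy P) (n : ℕ+) :
    freeAlgebraEquiv K h (FreeAlgebra.ι K n) = cls K R (P n) := by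
  have h1 : FreeAlgebra.equivMonoidAlgebraFreeMonoid (R := K) (FreeAlgebra.ι K n) =
      MonoidAlgebra.single (FreeMonoid.of n) 1 := FreeAlgebra.lift_ι_apply _ _
  refine (congrArg (MonoidAlgebra.domCongr K K (MulEquiv.ofBijective _ h)) h1).trans
    ((MonoidAlgebra.domCongr_single _ _ _).trans ?_)
  exact congrArg (of K R) (FreeMonoid.lift_eval_of _ _)

-- The equivalence carries monomials to basis elements, so gradings can be compared on spanning
-- sets.
variable {R} in
theorem freeAlgebraEquiv_prod {P : ℕ → F.Idx} (h : R.IsFreelyGeneratedBy P) (l : List ℕ+) :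
    freeAlgebraEquiv K h (l.map (FreeAlgebra.ι K)).prod =
      of K R (FreeMonoid.lift (fun n : ℕ+ => R.type (P n)) (FreeMonoid.ofList l)) := by
  rw [map_list_prod, List.map_map, FreeMonoid.lift_ofList, map_list_prod, List.map_map]
  exact congrArg List.prod (List.map_congr_left fun n _ => freeAlgebraEquiv_ι K h n)

variable {R} in
theorem map_freeAlgebraDegree (hF : ∀ i, IsGradedPoset (F.Carrier i))
    {P : ℕ → F.Idx} (hP : ∀ n, HasRank (F.Carrier (P n)) n)
    (h : R.IsFreelyGeneratedBy P) (d : ℕ) :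
    (freeAlgebraDegree K d).map (freeAlgebraEquiv K h).toLinearMap = gradedPiece K R d := by
  rw [freeAlgebraDegree, gradedPiece, Submodule.map_span]
  congr 1
  ext a
  constructor
  · rintro ⟨_, ⟨l, hl, rfl⟩, rfl⟩
    obtain ⟨i, hi⟩ := R.type_surj
      (FreeMonoid.lift (fun n : ℕ+ => R.type (P n)) (FreeMonoid.ofList l))
    refine ⟨i, (hasRank_iff_rank_eq hF).2 ((R.rank_of_type_eq_lift hF hP _ hi).trans hl), ?_⟩
    rw [cls, hi]
    exact freeAlgebraEquiv_prod K h l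
  · rintro ⟨i, hi, rfl⟩
    -- Surjectivity writes the type of `i` as a word, whose degree is the rank of `i`.
    obtain ⟨l, hl⟩ := h.2 (R.type i)
    refine ⟨_, ⟨l.toList, ?_, rfl⟩, ?_⟩
    · rw [← R.rank_of_type_eq_lift hF hP l hl.symm, (hasRank_iff_rank_eq hF).1 hi]
    · rw [cls, ← hl]
      exact freeAlgebraEquiv_prod K h l.toList

end IncidenceHopf

/-! ### The antipode formulas and the free algebra -/

theorem mainTheorem2 {K : Type w} [Field K] (F : HereditaryFamily.{u, v}) (R : HopfRelation F)
    (hR : R.IsUniform) (P : ℕ → F.Idx)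
    (hP : ∀ n, F.Indecomposable (P n) ∧ HasRank (F.Carrier (P n)) n) :
    -- the antipode of `H(P)` on `x_n`, `n = m + 1`, is minus the top right quasideterminant
    (∀ m : ℕ,
      IsUnit ((IncidenceHopf.rankMatrix K R P (m + 1)).submatrix
        (Fin.succAbove 0) (Fin.succAbove (Fin.last m))) ∧
      HopfAlgebra.antipode K (IncidenceHopf.cls K R (P (m + 1))) =
        -quasiDet (IncidenceHopf.rankMatrix K R P (m + 1)) 0 (Fin.last m)) ∧
    -- in the (free) noncommutative case `H(P)` is the free associative algebra
    (R.IsFreelyGeneratedBy P →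
      ∃ e : FreeAlgebra K ℕ+ ≃ₐ[K] IncidenceHopf K R,
        (∀ n : ℕ+, e (FreeAlgebra.ι K n) = IncidenceHopf.cls K R (P n)) ∧
        ∀ d : ℕ, (freeAlgebraDegree K d).map e.toLinearMap = IncidenceHopf.gradedPiece K R d) ∧
    -- in the commutative case the antipode is given by the classical determinant
    (∀ hc : R.IsCommutative, ∀ n : ℕ, 1 ≤ n →
      HopfAlgebra.antipode K (IncidenceHopf.cls K R (P n)) =
        (-1) ^ n * IncidenceHopf.det K hc (IncidenceHopf.rankMatrix K R P n)) := by
  have hG := hR.graded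
  have hP' := fun n => (hP n).2
  have h0 := IncidenceHopf.antipode_cls_zero K R hP'
  refine ⟨fun m => ?_, fun h => ⟨IncidenceHopf.freeAlgebraEquiv K h,
    IncidenceHopf.freeAlgebraEquiv_ι K h, IncidenceHopf.map_freeAlgebraDegree K hG hP' h⟩,
    fun hc n hn => ?_⟩
  · have hU : IsUnit ((IncidenceHopf.rankMatrix K R P (m + 1)).submatrix
        (Fin.succAbove 0) (Fin.succAbove (Fin.last m))) := by
      refine Matrix.isUnit_of_upper_unitriangular (fun i => ?_) fun i j hij => ?_
      · simpa using IncidenceHopf.rankMatrix_succ_castSucc K R hG hP' i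
      · simpa using IncidenceHopf.rankMatrix_succ_castSucc_of_lt K R hG hP' hij
    refine ⟨hU, ?_⟩
    rw [IncidenceHopf.antipode_cls_eq_neg_sum K hR hP m, sum_mul_eq_quasiDet _ hU]
    -- The last entry of the column is `S(x_0)`, as `m + 1 - (m + 1) = 0`.
    · simpa using h0
    · exact IncidenceHopf.sum_rankMatrix_succ_mul_antipode K hR hP
  · obtain ⟨m, rfl⟩ := Nat.exists_eq_add_of_le' hn
    have hdet := @det_eq_sum_mul _ (IncidenceHopf.commRing K hc) m
      (IncidenceHopf.rankMatrix K R P (m + 1))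
      (IncidenceHopf.rankMatrix_succ_castSucc K R hG hP')
      (fun _ _ => IncidenceHopf.rankMatrix_succ_castSucc_of_lt K R hG hP')
      (fun j => HopfAlgebra.antipode K (IncidenceHopf.cls K R (P (m + 1 - (j + 1)))))
      (by simpa using h0)
      (IncidenceHopf.sum_rankMatrix_succ_mul_antipode K hR hP)
    refine Eq.trans ?_ (congrArg ((-1) ^ (m + 1) * ·) hdet.symm)
    refine (IncidenceHopf.antipode_cls_eq_neg_sum K hR hP m).trans ?_
    -- The ring structure underlying `commRing` is the original one, so the determinant formula can
    -- be read in it. The signs `(-1) ^ (m + 1)` from the claim and `(-1) ^ m` from the cofactor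
    -- multiply to `-1`.
    change _ = (-1) ^ (m + 1) * ((-1) ^ m * _)
    rw [← mul_assoc, ← pow_add, show m + 1 + m = 2 * m + 1 by ring, pow_succ, pow_mul]
    simp
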